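/- Let $n\ge 0$ be an integer and let $\varphi:\mathbb R^n\to\mathbb R$ be a $C^2$, strictly convex function with $\varphi(x)/|x|\to\infty$ as $|x|\to\infty$, such that $\mu_\varphi(dx)=e^{-\varphi(x)}\,dx$ is a probability measure on $\mathbb R^n$ ($|\cdot|$ is the Euclidean norm). Assume that for every $R>0$ and every measurable map $z\mapsto y_0(z)$ from $\mathbb R^n$ to $\mathbb R^n$ with $|\nabla\varphi(y_0(z))|\le|\nabla\varphi(z)|+R$ for all $z$, $$\int\bigl(|z|+|y_0(z)|+R\bigr)^2\Bigl(|\nabla\varphi(z)|+\sup_{y:\,|y-z+y_0(z)|\le R}\|\mathrm{Hess}(\varphi)(y)\|\Bigr)\,d\mu_\varphi(z)<\infty .$$ Let $\varphi^*(x)=\sup_{z\in\mathbb R^n}\{x\cdot z-\varphi(z)\}$ be the Fenchel–Legendre transform of $\varphi$, and for $f>0$ in $L^1(\mu_\varphi)$ let $\mathrm{Ent}_{\mu_\varphi}(f)=\int f\log\bigl(f/\int f\,d\mu_\varphi\bigr)\,d\mu_\varphi$. Then for every $C^1$ function $g:\mathbb R^n\to\mathbb R$ with $\int e^g\,d\mu_\varphi<\infty$,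 $$\mathrm{Ent}_{\mu_\varphi}(e^g)\le\int\bigl[x\cdot\nabla g(x)-\varphi^*(\nabla\varphi(x))+\varphi^*(\nabla\varphi(x)-\nabla g(x))\bigr]e^{g(x)}\,d\mu_\varphi(x).$$ Here the expression in square brackets is nonnegative at every $x$, so that the right-hand side is well defined in $[0,\infty]$; it is finite whenever $g$ has compact support; and whenever it is finite, the integrand of $\mathrm{Ent}_{\mu_\varphi}(e^g)$ is $\mu_\varphi$-integrable and the inequality holds between real numbers. -/

import Mathlib

open MeasureTheory Filter Set

noncomputable section

/-- `ℝⁿ` with its Euclidean structure. -/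
abbrev Euc (n : ℕ) : Type := EuclideanSpace ℝ (Fin n)

/-- The measure `e^{-φ(x)} dx` on `ℝⁿ`. -/
def potentialMeasure {n : ℕ} (φ : Euc n → ℝ) : Measure (Euc n) :=
  volume.withDensity fun x => ENNReal.ofReal (Real.exp (-φ x))

/-- The Fenchel-Legendre transform `φ*(x) = sup_z (x · z - φ(z))`. The supremum is finite for the
potentials considered here, see `bddAbove_range_legendre`. -/
def legendre {n : ℕ} (φ : Euc n → ℝ) (x : Euc n) : ℝ :=
  ⨆ z : Euc n, (inner ℝ x z - φ z)

/-- Super-linearity: `φ(x) / |x| → ∞` as `|x| → ∞`. -/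
def SuperLinear {n : ℕ} (φ : Euc n → ℝ) : Prop :=
  Tendsto (fun x : Euc n => φ x / ‖x‖) (Bornology.cobounded (Euc n)) atTop

/-- The supremum defining `legendre φ x` is taken over a set that is bounded above. -/
theorem bddAbove_range_legendre {n : ℕ} (φ : Euc n → ℝ) (hc : Continuous φ)
    (hs : SuperLinear φ) (x : Euc n) :
    BddAbove (range fun z : Euc n => inner ℝ x z - φ z) := by
  have h1 : ∀ᶠ z in Bornology.cobounded (Euc n), ‖x‖ ≤ φ z / ‖z‖ := hs.eventually_ge_atTop _
  rw [Metric.cobounded_eq_cocompact, eventually_iff, mem_cocompact] at h1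
  obtain ⟨K, hK, hKs⟩ := h1
  have hcont : Continuous fun z : Euc n => inner ℝ x z - φ z :=
    (continuous_const.inner continuous_id).sub hc
  obtain ⟨C, hC⟩ := (hK.image hcont).bddAbove
  refine ⟨max (max C 0) (-φ 0), ?_⟩
  rintro _ ⟨z, rfl⟩
  by_cases hz : z ∈ K
  · exact le_max_of_le_left (le_max_of_le_left (hC ⟨z, hz, rfl⟩))
  · have h2 : ‖x‖ ≤ φ z / ‖z‖ := hKs hz
    rcases eq_or_ne z 0 with rfl | h0
    · simp
    · have h3 : ‖x‖ * ‖z‖ ≤ φ z := (le_div_iff₀ (norm_pos_iff.mpr h0)).1 h2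
      have h4 := real_inner_le_norm x z
      exact le_max_of_le_left (le_max_of_le_right (by simp only; linarith))

/-- The Hessian of `φ` at `y`, as a linear operator (the derivative of the gradient field);
its norm is the operator norm. -/
def hessian {n : ℕ} (φ : Euc n → ℝ) (y : Euc n) : Euc n →L[ℝ] Euc n :=
  fderiv ℝ (gradient φ) y

/-- The integrability hypothesis on the potential: for every `R > 0` and every measurable choice
`z ↦ y₀(z)` of points with `|∇φ(y₀)| ≤ |∇φ(z)| + R`,
`∫ (|z| + |y₀| + R)² (|∇φ(z)| + sup_{|y - z + y₀| ≤ R} ‖Hess φ(y)‖) dμ_φ(z) < ∞`. -/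
def IntegrabilityHyp {n : ℕ} (φ : Euc n → ℝ) : Prop :=
  ∀ R : ℝ, 0 < R → ∀ y₀ : Euc n → Euc n, Measurable y₀ →
    (∀ z, ‖gradient φ (y₀ z)‖ ≤ ‖gradient φ z‖ + R) →
    ∫⁻ z, ENNReal.ofReal ((‖z‖ + ‖y₀ z‖ + R) ^ 2) *
      (‖gradient φ z‖ₑ + ⨆ y ∈ {y : Euc n | ‖y - z + y₀ z‖ ≤ R}, ‖hessian φ y‖ₑ)
      ∂(potentialMeasure φ) < ⊤

/-- The integrand of the entropy, `f log (f / ∫ f dμ)`. -/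
def entIntegrand {n : ℕ} (μ : Measure (Euc n)) (f : Euc n → ℝ) (x : Euc n) : ℝ :=
  f x * Real.log (f x / ∫ y, f y ∂μ)

/-- The entropy `Ent_μ(f) = ∫ f log (f / ∫ f dμ) dμ`. -/
def ent {n : ℕ} (μ : Measure (Euc n)) (f : Euc n → ℝ) : ℝ :=
  ∫ x, entIntegrand μ f x ∂μ

/-- The energy density `x · ∇g(x) - φ*(∇φ(x)) + φ*(∇φ(x) - ∇g(x))`. -/
def energyDensity {n : ℕ} (φ g : Euc n → ℝ) (x : Euc n) : ℝ :=
  inner ℝ x (gradient g x) - legendre φ (gradient φ x)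
    + legendre φ (gradient φ x - gradient g x)

end

open scoped Topology

noncomputable section

/-! This is a mass transport argument. Put `u = e^(g-φ)`, `v = e^(-φ)`, and suppose a map `T` with
values in `K` carries `u/∫u` to `v/∫_K v`. Taking logarithms in the change of variables equation,
then using `log det DT ≤ tr DT - n` and integrating by parts, bounds the entropy of `u` by the
integral of `⟨∇u(x), x - T(x)⟩ + u(x) log v(T(x))`. Only the values of `T` enter, so any `F`
dominating this expression for every `y ∈ K` in place of `T(x)` will do. This is
`EntropyTransportIneq`, where `T` no longer appears.

In this form the inequality tensorizes: it is proved on an interval by monotone rearrangement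
(`entropyTransportIneq_Icc`), passes to products (`EntropyTransportIneq.prod`), and so holds on
cubes of `ℝⁿ`. No transport map in dimension `n` is ever constructed.

For the potential, `⟨∇g - ∇φ, x - y⟩ - φ(y)` is affine in `y` minus `φ(y)`, so its supremum over `y`
is a value of `φ*`; it equals the energy density minus `φ(x)`. Cutoffs make `u` compactly supported.
They are removed first, with the cube fixed so that `y` stays bounded; then the cube fills the space
and `log ∫_K e^(-φ)` tends to `0`. -/

/-- Entropy inequality obtained by transporting a `C¹` density `u` to the density `v` on `K`:
whenever `F` dominates `x ↦ ⟨∇u(x), x - y⟩ + u(x) log v(y)` for every `y ∈ K`, then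
`∫ u log u - Z log Z + Z log ∫_K v ≤ ∫ F`, where `Z = ∫ u`. -/
def EntropyTransportIneq {E : Type*} [NormedAddCommGroup E] [NormedSpace ℝ E] [MeasurableSpace E]
    (μ : Measure E) (K : Set E) : Prop :=
  ∀ u v F : E → ℝ, ContDiff ℝ 1 u → HasCompactSupport u → (∀ x, 0 ≤ u x) →
    Continuous v → (∀ x, 0 < v x) → Continuous F → HasCompactSupport F →
    (∀ x, ∀ y ∈ K, fderiv ℝ u x (x - y) + u x * Real.log (v y) ≤ F x) →
    (∫ x, u x * Real.log (u x) ∂μ) - (∫ x, u x ∂μ) * Real.log (∫ x, u x ∂μ)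
      + (∫ x, u x ∂μ) * Real.log (∫ y in K, v y ∂μ) ≤ ∫ x, F x ∂μ

/-! ### The transport inequality on an interval -/

theorem HasCompactSupport.mul_log {E : Type*} [TopologicalSpace E] {u : E → ℝ}
    (hu : HasCompactSupport u) : HasCompactSupport fun x => u x * Real.log (u x) :=
  hu.mul_right

/-- The monotone map `T` solving `v(T) T' = (V/Z) u` is used. The bound `log T' ≤ T' - 1`,
multiplied by `u`, leaves the exact derivative of `u (T - id)`, whose integral is zero. -/
theorem entropyTransportIneq_Icc {a b : ℝ} (hab : a < b) :
    EntropyTransportIneq (volume : Measure ℝ) (Icc a b) := by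
  intro u v F hu hus hu0 hv hv0 hF hFs h
  have huc := hu.continuous
  have hui : Integrable u := huc.integrable_of_hasCompactSupport hus
  have hFi : Integrable F := hF.integrable_of_hasCompactSupport hFs
  have huli : Integrable fun x => u x * Real.log (u x) :=
    (Real.continuous_mul_log.comp huc).integrable_of_hasCompactSupport hus.mul_log
  set Z := ∫ x, u x with hZ
  -- The transport divides by `Z`. If `Z = 0` then `u = 0`, and the hypothesis at `y = a` reduces to
  -- `0 ≤ F`.
  rcases (integral_nonneg hu0 : 0 ≤ Z).eq_or_lt with h0 | hZpos
  · have hu_zero : u = 0 := by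
      have h1 : u =ᵐ[volume] 0 := (integral_eq_zero_iff_of_nonneg hu0 hui).1 h0.symm
      exact (Continuous.ae_eq_iff_eq volume huc continuous_const).1 h1
    have : 0 ≤ ∫ x, F x := by
      refine integral_nonneg fun x => ?_
      have := h x a (left_mem_Icc.2 hab.le)
      simpa [hu_zero] using this
    have hZ0 : Z = 0 := h0.symm
    rw [hZ0]
    simpa [hu_zero] using this
  have hVdef : ∫ y in Icc a b, v y = ∫ y in a..b, v y := by
    rw [intervalIntegral.integral_of_le hab.le, integral_Icc_eq_integral_Ioc]
  rw [hVdef]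
  set G : ℝ → ℝ := fun y => ∫ t in a..y, v t with hG
  set V := ∫ y in a..b, v y with hV
  have hVpos : 0 < V := intervalIntegral.intervalIntegral_pos_of_pos
    (hv.intervalIntegrable _ _) hv0 hab
  have hGd : ∀ y, HasStrictDerivAt G (v y) y := fun y => hv.integral_hasStrictDerivAt a y
  have hGc : Continuous G := continuous_iff_continuousAt.2 fun y => (hGd y).hasDerivAt.continuousAt
  have hGm : StrictMono G := strictMono_of_deriv_pos fun y => by
    rw [(hGd y).hasDerivAt.deriv]; exact hv0 y
  have hGe : Topology.IsOpenEmbedding G := by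
    refine .of_continuous_injective_isOpenMap hGc hGm.injective ?_
    exact isOpenMap_of_hasStrictDerivAt hGd fun y => (hv0 y).ne'
  -- The distribution function of `u`, rescaled to total mass `V` to match `G`; thus `T = G⁻¹ ∘ S`.
  set S : ℝ → ℝ := fun x => V / Z * ∫ t in Iic x, u t with hS
  have hSd : ∀ x, HasDerivAt S (V / Z * u x) x := by
    intro x
    have h1 : S = fun x => V / Z * ((∫ t in Iic 0, u t) + ∫ t in (0:ℝ)..x, u t) := by
      ext x
      simp only [hS]
      rw [← intervalIntegral.integral_Iic_sub_Iic hui.integrableOn hui.integrableOn]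
      ring
    rw [h1]
    exact ((huc.integral_hasStrictDerivAt 0 x).hasDerivAt.const_add _).const_mul _
  have hSmem : ∀ x, S x ∈ Icc (G a) (G b) := by
    intro x
    have h1 : 0 ≤ ∫ t in Iic x, u t := integral_nonneg hu0
    have h2 : ∫ t in Iic x, u t ≤ Z := setIntegral_le_integral hui (ae_of_all _ hu0)
    refine ⟨?_, ?_⟩
    · simp only [hG, hS, intervalIntegral.integral_same]; positivity
    · simp only [hG, hS]
      rw [div_mul_eq_mul_div, div_le_iff₀ hZpos]
      gcongr
  have hTex : ∀ x, ∃ y ∈ Icc a b, G y = S x := fun x =>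
    intermediate_value_Icc hab.le hGc.continuousOn (hSmem x)
  choose T hTab hGT using hTex
  set e := hGe.toOpenPartialHomeomorph G with he
  have hTe : T = fun x => e.symm (S x) := by
    ext x
    rw [← hGT x]
    exact (e.left_inv (x := T x) (by simp [he])).symm
  set T' : ℝ → ℝ := fun x => (v (T x))⁻¹ * (V / Z * u x) with hT'
  have hTd : ∀ x, HasDerivAt T (T' x) x := by
    intro x
    have h1 : HasDerivAt e.symm (v (T x))⁻¹ (S x) := by
      refine e.hasDerivAt_symm ?_ (hv0 _).ne' ?_
      · exact ⟨T x, mem_univ _, hGT x⟩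
      · have : e.symm (S x) = T x := by rw [hTe]
        rw [this]
        exact (hGd (T x)).hasDerivAt
    have h2 := h1.comp x (hSd x)
    have h3 : (e.symm : ℝ → ℝ) ∘ S = T := by rw [hTe]; rfl
    rwa [h3] at h2
  have hTc : Continuous T := continuous_iff_continuousAt.2 fun y => (hTd y).continuousAt
  have hT'c : Continuous T' := by
    simp only [hT']
    exact ((hv.comp hTc).inv₀ fun x => (hv0 _).ne').mul (continuous_const.mul huc)
  have hduc : Continuous (deriv u) := hu.continuous_deriv le_rfl
  -- The derivative of `u (T - id)`.
  set D : ℝ → ℝ := fun x => deriv u x * (T x - x) + u x * (T' x - 1) with hD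
  have hDi : Integrable D := by
    refine Integrable.add ?_ ?_
    · exact (hduc.mul (hTc.sub continuous_id)).integrable_of_hasCompactSupport hus.deriv.mul_right
    · exact (huc.mul (hT'c.sub continuous_const)).integrable_of_hasCompactSupport hus.mul_right
  have hDint : ∫ x, D x = 0 := by
    refine integral_eq_zero_of_hasDerivAt_of_integrable (f := fun x => u x * (T x - x)) ?_ hDi ?_
    · intro x
      exact ((hu.differentiable one_ne_zero).differentiableAt.hasDerivAt).mul
        ((hTd x).sub (hasDerivAt_id x))
    · exact (huc.mul (hTc.sub continuous_id)).integrable_of_hasCompactSupport hus.mul_right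
  have hpt : ∀ x, u x * Real.log (u x) - u x * Real.log Z + u x * Real.log V ≤ F x + D x := by
    intro x
    have h1 := h x (T x) (hTab x)
    have h2 : fderiv ℝ u x (x - T x) = (x - T x) * deriv u x := by
      rw [fderiv_eq_smul_deriv, smul_eq_mul]
    rw [h2] at h1
    suffices u x * Real.log (u x) - u x * Real.log Z + u x * Real.log V
        - u x * Real.log (v (T x)) ≤ u x * (T' x - 1) by
      simp only [hD]; linarith
    rcases (hu0 x).eq_or_lt with h0 | hpos
    · simp [← h0]
    have h3 : 0 < T' x := mul_pos (inv_pos.2 (hv0 _)) (by positivity)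
    have h4 : Real.log (T' x) = Real.log (u x) - Real.log Z + Real.log V
        - Real.log (v (T x)) := by
      simp only [hT']
      rw [Real.log_mul (inv_pos.2 (hv0 _)).ne' (by positivity), Real.log_inv,
        Real.log_mul (by positivity) hpos.ne', Real.log_div hVpos.ne' hZpos.ne']
      ring
    have h5 := mul_le_mul_of_nonneg_left (Real.log_le_sub_one_of_pos h3) hpos.le
    rw [h4] at h5
    linarith
  have h1 : Integrable fun x => u x * Real.log (u x) - u x * Real.log Z :=
    huli.sub (hui.mul_const _)
  have h2 : Integrable fun x => u x * Real.log V := hui.mul_const _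
  have hint := integral_mono (h1.add h2) (hFi.add hDi) hpt
  rw [integral_add' h1 h2, integral_add' hFi hDi, integral_sub huli (hui.mul_const _), hDint,
    integral_mul_const, integral_mul_const] at hint
  linarith

/-! ### Partial integrals of compactly supported functions on a product -/

theorem HasCompactSupport.comp_prodMk_left {E₁ E₂ H : Type*} [TopologicalSpace E₁]
    [TopologicalSpace E₂] [T2Space E₂] [Zero H] {f : E₁ × E₂ → H}
    (hf : HasCompactSupport f) (x : E₁) :
    HasCompactSupport fun y => f (x, y) := by
  refine HasCompactSupport.intro (hf.isCompact.image continuous_snd) fun y hy => ?_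
  by_contra h
  exact hy ⟨(x, y), subset_tsupport _ h, rfl⟩

theorem integral_eq_setIntegral_image_snd {E₁ E₂ H : Type*} [TopologicalSpace E₁]
    [TopologicalSpace E₂] [NormedAddCommGroup H] [NormedSpace ℝ H] [MeasurableSpace E₂]
    {μ₂ : Measure E₂} {f : E₁ × E₂ → H} (x : E₁) :
    ∫ y, f (x, y) ∂μ₂ = ∫ y in Prod.snd '' tsupport f, f (x, y) ∂μ₂ := by
  refine (setIntegral_eq_integral_of_forall_compl_eq_zero fun y hy => ?_).symm
  by_contra h
  exact hy ⟨(x, y), subset_tsupport _ h, rfl⟩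

theorem HasCompactSupport.integral_prodMk {E₁ E₂ H : Type*} [TopologicalSpace E₁]
    [TopologicalSpace E₂] [T2Space E₁] [NormedAddCommGroup H] [NormedSpace ℝ H]
    [MeasurableSpace E₂] {μ₂ : Measure E₂} {f : E₁ × E₂ → H} (hf : HasCompactSupport f) :
    HasCompactSupport fun x => ∫ y, f (x, y) ∂μ₂ := by
  refine HasCompactSupport.intro (hf.isCompact.image continuous_fst) fun x hx => ?_
  have : ∀ y, f (x, y) = 0 := fun y => by
    by_contra h
    exact hx ⟨(x, y), subset_tsupport _ h, rfl⟩
  simp [this]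

section ParametricIntegral

variable {E₁ E₂ H : Type*} [NormedAddCommGroup E₁] [NormedSpace ℝ E₁] [FiniteDimensional ℝ E₁]
  [NormedAddCommGroup E₂] [NormedSpace ℝ E₂]
  [NormedAddCommGroup H] [NormedSpace ℝ H]
  [MeasurableSpace E₂] [BorelSpace E₂] {μ₂ : Measure E₂} [IsFiniteMeasureOnCompacts μ₂]

theorem HasCompactSupport.continuous_integral_prodMk [FiniteDimensional ℝ E₂] {f : E₁ × E₂ → H}
    (hf : HasCompactSupport f) (hfc : Continuous f) : Continuous fun x => ∫ y, f (x, y) ∂μ₂ := by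
  rw [funext fun x => integral_eq_setIntegral_image_snd (f := f) (μ₂ := μ₂) x]
  exact continuous_parametric_integral_of_continuous (f := fun x y => f (x, y)) hfc
    (hf.isCompact.image continuous_snd)

theorem HasCompactSupport.hasFDerivAt_integral_prodMk {f : E₁ × E₂ → ℝ}
    (hf : HasCompactSupport f) (hfc : ContDiff ℝ 1 f) (x : E₁) :
    HasFDerivAt (fun x => ∫ y, f (x, y) ∂μ₂)
      (∫ y, (fderiv ℝ f (x, y)).comp (.inl ℝ E₁ E₂) ∂μ₂) x := by
  have hdc : Continuous (fderiv ℝ f) := hfc.continuous_fderiv one_ne_zero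
  have hds : HasCompactSupport (fderiv ℝ f) := hf.fderiv ℝ
  obtain ⟨C, hC⟩ := hds.exists_bound_of_continuous hdc
  set s := Prod.snd '' tsupport (fderiv ℝ f) with hs
  have hsc : IsCompact s := hds.isCompact.image continuous_snd
  refine hasFDerivAt_integral_of_dominated_of_fderiv_le (s := univ)
    (F' := fun x y => (fderiv ℝ f (x, y)).comp (.inl ℝ E₁ E₂))
    (bound := s.indicator fun _ => C) univ_mem ?_ ?_ ?_ ?_ ?_ ?_
  · exact Eventually.of_forall fun x =>
      (hfc.continuous.comp (by fun_prop)).aestronglyMeasurable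
  · exact (hfc.continuous.comp (by fun_prop)).integrable_of_hasCompactSupport
      (hf.comp_prodMk_left x)
  · exact ((hdc.comp (by fun_prop : Continuous fun y => (x, y))).clm_comp
      continuous_const).aestronglyMeasurable
  · refine ae_of_all _ fun y x _ => ?_
    by_cases hy : y ∈ s
    · rw [indicator_of_mem hy]
      calc _ ≤ ‖fderiv ℝ f (x, y)‖ * ‖ContinuousLinearMap.inl ℝ E₁ E₂‖ :=
            ContinuousLinearMap.opNorm_comp_le _ _
        _ ≤ ‖fderiv ℝ f (x, y)‖ * 1 := by
            gcongr; exact ContinuousLinearMap.norm_inl_le_one ..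
        _ ≤ C := by rw [mul_one]; exact hC _
    · rw [indicator_of_notMem hy]
      have : fderiv ℝ f (x, y) = 0 := by
        by_contra h
        exact hy ⟨(x, y), subset_tsupport _ h, rfl⟩
      simp [this]
  · exact (integrable_indicator_iff hsc.isClosed.measurableSet).2
      (integrableOn_const hsc.measure_lt_top.ne)
  · refine ae_of_all _ fun y x _ => ?_
    exact ((hfc.differentiable one_ne_zero) (x, y)).hasFDerivAt.comp x (hasFDerivAt_prodMk_left x y)

end ParametricIntegral

/-! ### Tensorization -/

section Product

variable {E₁ E₂ : Type*} [NormedAddCommGroup E₁] [NormedSpace ℝ E₁] [FiniteDimensional ℝ E₁]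
  [NormedAddCommGroup E₂] [NormedSpace ℝ E₂] [FiniteDimensional ℝ E₂]
  [MeasurableSpace E₁] [BorelSpace E₁] [MeasurableSpace E₂] [BorelSpace E₂]
  {μ₁ : Measure E₁} {μ₂ : Measure E₂} [IsFiniteMeasureOnCompacts μ₁]
  [IsFiniteMeasureOnCompacts μ₂] [SFinite μ₁] [SFinite μ₂]

/-- For fixed `x` and `y ∈ K₁`, the inequality on the second factor, with the first-variable part of
`fderiv ℝ u` moved into `F`, is exactly the domination hypothesis on the first factor for the
marginals `U`, `V`. The term `U log U` it produces cancels against the one in the entropy of `U`. -/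
theorem EntropyTransportIneq.prod {K₁ : Set E₁} {K₂ : Set E₂} (h₁ : EntropyTransportIneq μ₁ K₁)
    (h₂ : EntropyTransportIneq μ₂ K₂) (hK₁ : IsCompact K₁) (hK₂ : IsCompact K₂)
    (hK₂pos : μ₂ K₂ ≠ 0) :
    EntropyTransportIneq (μ₁.prod μ₂) (K₁ ×ˢ K₂) := by
  intro u v F hu hus hu0 hv hv0 hF hFs h
  have huc := hu.continuous
  have hulc : Continuous fun p => u p * Real.log (u p) := Real.continuous_mul_log.comp huc
  have huls := hus.mul_log
  have hui : Integrable u (μ₁.prod μ₂) := huc.integrable_of_hasCompactSupport hus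
  have huli : Integrable (fun p => u p * Real.log (u p)) (μ₁.prod μ₂) :=
    hulc.integrable_of_hasCompactSupport huls
  have hFi : Integrable F (μ₁.prod μ₂) := hF.integrable_of_hasCompactSupport hFs
  have hdc : Continuous (fderiv ℝ u) := hu.continuous_fderiv one_ne_zero
  have hds : HasCompactSupport (fderiv ℝ u) := hus.fderiv ℝ
  set U : E₁ → ℝ := fun x => ∫ y, u (x, y) ∂μ₂ with hU
  set V : E₁ → ℝ := fun x => ∫ y in K₂, v (x, y) ∂μ₂ with hV
  set U' : E₁ → E₁ →L[ℝ] ℝ :=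
    fun x => ∫ y, (fderiv ℝ u (x, y)).comp (.inl ℝ E₁ E₂) ∂μ₂ with hU'
  have hUd : ∀ x, HasFDerivAt U (U' x) x := fun x => hus.hasFDerivAt_integral_prodMk hu x
  have hd's : HasCompactSupport fun p => (fderiv ℝ u p).comp (.inl ℝ E₁ E₂) :=
    hds.comp_left (g := fun L : E₁ × E₂ →L[ℝ] ℝ => L.comp (.inl ℝ E₁ E₂)) (by simp)
  have hd'c : Continuous fun p => (fderiv ℝ u p).comp (.inl ℝ E₁ E₂) :=
    hdc.clm_comp continuous_const
  have hU1 : ContDiff ℝ 1 U := by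
    refine contDiff_one_iff_hasFDerivAt.2 ⟨U', ?_, hUd⟩
    exact hd's.continuous_integral_prodMk hd'c
  have hUs : HasCompactSupport U := hus.integral_prodMk
  have hU0 : ∀ x, 0 ≤ U x := fun x => integral_nonneg fun y => hu0 _
  have hVc : Continuous V := continuous_parametric_integral_of_continuous
    (f := fun x y => v (x, y)) hv hK₂
  have hV0 : ∀ x, 0 < V x := by
    intro x
    have hvc : Continuous fun y => v (x, y) := by fun_prop
    refine (setIntegral_pos_iff_support_of_nonneg_ae (ae_of_all _ fun y => (hv0 _).le)
      (hvc.continuousOn.integrableOn_compact hK₂)).2 ?_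
    have : Function.support (fun y => v (x, y)) = univ :=
      eq_univ_of_forall fun y => (hv0 _).ne'
    rw [this, univ_inter]
    exact pos_iff_ne_zero.2 hK₂pos
  set A : E₁ → ℝ := fun x => ∫ y, u (x, y) * Real.log (u (x, y)) ∂μ₂ with hA
  set Φ : E₁ → ℝ := fun x => ∫ y, F (x, y) ∂μ₂ with hΦ
  have hAc : Continuous A := huls.continuous_integral_prodMk hulc
  have hAs : HasCompactSupport A := huls.integral_prodMk
  have hΦc : Continuous Φ := hFs.continuous_integral_prodMk hF
  have hΦs : HasCompactSupport Φ := hFs.integral_prodMk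
  have hULc : Continuous fun x => U x * Real.log (U x) :=
    Real.continuous_mul_log.comp hU1.continuous
  have hULs := hUs.mul_log
  have key := h₁ U V (fun x => Φ x - A x + U x * Real.log (U x)) hU1 hUs hU0 hVc hV0
    ((hΦc.sub hAc).add hULc) ((hΦs.sub hAs).add hULs) ?_
  · have hAi : Integrable A μ₁ := hAc.integrable_of_hasCompactSupport hAs
    have hΦi : Integrable Φ μ₁ := hΦc.integrable_of_hasCompactSupport hΦs
    have hULi : Integrable (fun x => U x * Real.log (U x)) μ₁ :=
      hULc.integrable_of_hasCompactSupport hULs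
    have hΦAi : Integrable (fun x => Φ x - A x) μ₁ := hΦi.sub hAi
    rw [integral_add hΦAi hULi, integral_sub hΦi hAi] at key
    have hvi : IntegrableOn v (K₁ ×ˢ K₂) (μ₁.prod μ₂) :=
      hv.continuousOn.integrableOn_compact (hK₁.prod hK₂)
    rw [integral_prod _ hui, integral_prod _ huli, integral_prod _ hFi, setIntegral_prod _ hvi]
    linarith
  · intro x y hy
    rw [(hUd x).fderiv]
    have hsx : HasCompactSupport fun z => (fderiv ℝ u (x, z)).comp (.inl ℝ E₁ E₂) :=
      hd's.comp_prodMk_left x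
    have hcx : Continuous fun z => (fderiv ℝ u (x, z)).comp (.inl ℝ E₁ E₂) :=
      hd'c.comp (by fun_prop)
    have hix := hcx.integrable_of_hasCompactSupport hsx (μ := μ₂)
    have hU'xy : U' x (x - y) = ∫ z, fderiv ℝ u (x, z) (x - y, 0) ∂μ₂ := by
      simp only [hU']
      rw [ContinuousLinearMap.integral_apply hix]
      simp
    have hs2 : HasCompactSupport fun z => fderiv ℝ u (x, z) (x - y, 0) :=
      (hds.comp_prodMk_left x).comp_left (g := fun L : E₁ × E₂ →L[ℝ] ℝ => L (x - y, 0)) (by simp)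
    have hc2 : Continuous fun z => fderiv ℝ u (x, z) (x - y, 0) :=
      (hdc.comp (by fun_prop : Continuous fun z => (x, z))).clm_apply continuous_const
    have hFxc : Continuous fun z => F (x, z) := by fun_prop
    have hFxs := hFs.comp_prodMk_left x
    have hux : ContDiff ℝ 1 fun z => u (x, z) := hu.comp (by fun_prop)
    have k := h₂ (fun z => u (x, z)) (fun z => v (y, z))
      (fun z => F (x, z) - fderiv ℝ u (x, z) (x - y, 0)) hux (hus.comp_prodMk_left x)
      (fun z => hu0 _) (by fun_prop) (fun z => hv0 _) (hFxc.sub hc2) (hFxs.sub hs2) ?_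
    · rw [integral_sub (hFxc.integrable_of_hasCompactSupport hFxs)
        (hc2.integrable_of_hasCompactSupport hs2), ← hU'xy] at k
      linarith
    · intro z w hw
      have h3 := h (x, z) (y, w) ⟨hy, hw⟩
      have h4 : HasFDerivAt (fun z => u (x, z))
          ((fderiv ℝ u (x, z)).comp (.inr ℝ E₁ E₂)) z :=
        ((hu.differentiable one_ne_zero) (x, z)).hasFDerivAt.comp z (hasFDerivAt_prodMk_right x z)
      rw [h4.fderiv]
      have h5 : ((x, z) - (y, w) : E₁ × E₂) = (x - y, 0) + (0, z - w) := by simp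
      rw [h5, map_add] at h3
      simp only [ContinuousLinearMap.comp_apply, ContinuousLinearMap.inr_apply]
      linarith

end Product

/-! ### Cubes in Euclidean space -/

section Transfer

variable {E E' : Type*} [NormedAddCommGroup E] [NormedSpace ℝ E]
  [NormedAddCommGroup E'] [NormedSpace ℝ E']
  [MeasurableSpace E] [BorelSpace E] [MeasurableSpace E'] [BorelSpace E']
  {μ : Measure E} {μ' : Measure E'}

theorem EntropyTransportIneq.of_measurePreserving {K : Set E} (h : EntropyTransportIneq μ K)
    (L : E ≃L[ℝ] E') (hL : MeasurePreserving L μ μ') : EntropyTransportIneq μ' (L.symm ⁻¹' K) := by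
  intro u v F hu hus hu0 hv hv0 hF hFs hle
  have hemb : MeasurableEmbedding L := L.toHomeomorph.measurableEmbedding
  have key := h (u ∘ L) (v ∘ L) (F ∘ L) (hu.comp L.contDiff)
    (hus.comp_homeomorph L.toHomeomorph) (fun _ => hu0 _) (hv.comp L.continuous) (fun _ => hv0 _)
    (hF.comp L.continuous) (hFs.comp_homeomorph L.toHomeomorph) ?_
  · have e : K = L ⁻¹' (L.symm ⁻¹' K) := by ext; simp
    simp only [Function.comp_apply] at key
    rw [e, hL.setIntegral_preimage_emb hemb, hL.integral_comp hemb u, hL.integral_comp hemb F,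
      hL.integral_comp hemb (fun x => u x * Real.log (u x))] at key
    exact key
  · intro x y hy
    have h1 := hle (L x) (L y) (by simpa using hy)
    rw [L.comp_right_fderiv]
    simpa using h1

theorem entropyTransportIneq_pi {a b : ℝ} (hab : a < b) (n : ℕ) :
    EntropyTransportIneq (volume : Measure (Fin n → ℝ)) (Icc (fun _ => a) fun _ => b) := by
  induction n with
  | zero =>
    -- In dimension zero volume is a Dirac mass, and the claim is the hypothesis at the only pair of
    -- points.
    intro u v F hu hus hu0 hv hv0 hF hFs h
    have h1 := h 0 0 (by simp [Subsingleton.elim (0 : Fin 0 → ℝ) fun _ => a,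
      Subsingleton.elim (fun _ : Fin 0 => b) fun _ => a])
    have hI : Icc (fun _ : Fin 0 => a) (fun _ => b) = univ :=
      eq_univ_of_forall fun x => by
        simp [Subsingleton.elim x fun _ => a, Subsingleton.elim (fun _ : Fin 0 => b) fun _ => a]
    rw [hI, Measure.restrict_univ]
    simp only [volume_pi, Measure.pi_of_empty (x := (0 : Fin 0 → ℝ)), integral_dirac]
    rw [Subsingleton.elim ((0 : Fin 0 → ℝ) - 0) 0, map_zero] at h1
    simpa using h1
  | succ n ih =>
    have h1 := (entropyTransportIneq_Icc hab).prod ih isCompact_Icc isCompact_Icc ?_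
    · have hmp : MeasurePreserving (Fin.consEquivL ℝ fun _ : Fin (n + 1) => ℝ)
          (volume.prod volume) volume := by
        have hfun : ⇑(Fin.consEquivL ℝ fun _ : Fin (n + 1) => ℝ)
            = ⇑(MeasurableEquiv.piFinSuccAbove (fun _ : Fin (n + 1) => ℝ) 0).symm := by
          ext p i
          refine Fin.cases ?_ (fun j => ?_) i <;> simp [MeasurableEquiv.piFinSuccAbove]
        rw [hfun]
        exact (volume_preserving_piFinSuccAbove (fun _ : Fin (n + 1) => ℝ) 0).symm _
      have h2 := h1.of_measurePreserving _ hmp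
      convert h2 using 1
      ext x
      simp only [mem_Icc, mem_preimage, mem_prod, Pi.le_def, Fin.forall_fin_succ]
      exact ⟨fun h => ⟨⟨h.1.1, h.2.1⟩, h.1.2, h.2.2⟩, fun h => ⟨⟨h.1.1, h.2.1⟩, h.1.2, h.2.2⟩⟩
    · rw [Real.volume_Icc_pi]
      exact Finset.prod_ne_zero_iff.2 fun i _ => by simpa using hab

/-- The cube `[a, b]ⁿ` in Euclidean space. -/
def eucCube (n : ℕ) (a b : ℝ) : Set (Euc n) := {x | ∀ i, x i ∈ Icc a b}

theorem entropyTransportIneq_eucCube {a b : ℝ} (hab : a < b) (n : ℕ) :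
    EntropyTransportIneq (volume : Measure (Euc n)) (eucCube n a b) := by
  have h := (entropyTransportIneq_pi hab n).of_measurePreserving (μ' := volume)
    (EuclideanSpace.equiv (Fin n) ℝ).symm (PiLp.volume_preserving_toLp (Fin n))
  convert h using 1
  ext x
  simp only [eucCube, mem_Icc, mem_preimage, Pi.le_def, forall_and, mem_ofPred_eq]
  rfl

end Transfer

/-! ### Cutoffs and a Fatou criterion -/

/-- Smooth cutoff functions exhausting the space, with `‖x‖ ‖χ'(x)‖` bounded. -/
theorem exists_cutoff_seq (E : Type*) [NormedAddCommGroup E] [NormedSpace ℝ E]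
    [FiniteDimensional ℝ E] [HasContDiffBump E] :
    ∃ (χ : ℕ → E → ℝ) (C : ℝ), (∀ k, ContDiff ℝ 1 (χ k)) ∧ (∀ k, HasCompactSupport (χ k)) ∧
      (∀ k x, 0 ≤ χ k x) ∧ (∀ k x, χ k x ≤ 1) ∧ (∀ x, Tendsto (fun k => χ k x) atTop (𝓝 1)) ∧
      (∀ k x, (1 + ‖x‖) * ‖fderiv ℝ (χ k) x‖ ≤ C) ∧
      ∀ x, Tendsto (fun k => ‖fderiv ℝ (χ k) x‖) atTop (𝓝 0) := by
  -- The cutoffs are the dilates `b(x/(k+1))`. Dilation scales the derivative by `1/(k+1)`, which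
  -- keeps `‖x‖ ‖χ'(x)‖` bounded uniformly in `k`.
  let b : ContDiffBump (0 : E) := ⟨1, 2, one_pos, one_lt_two⟩
  have hb : ContDiff ℝ 1 b := b.contDiff
  have hbs : HasCompactSupport b := b.hasCompactSupport
  obtain ⟨C₁, hC₁⟩ := (hbs.fderiv ℝ).exists_bound_of_continuous
    (hb.continuous_fderiv one_ne_zero)
  obtain ⟨C₂, hC₂⟩ := ((hbs.fderiv ℝ).norm.mul_left
    (f := fun x : E => ‖x‖)).exists_bound_of_continuous (continuous_norm.mul (hb.continuous_fderiv one_ne_zero).norm)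
  have hc0 : Tendsto (fun k : ℕ => ((k : ℝ) + 1)⁻¹) atTop (𝓝 0) := by
    simpa using tendsto_one_div_add_atTop_nhds_zero_nat (𝕜 := ℝ)
  have hcpos : ∀ k : ℕ, (0 : ℝ) < ((k : ℝ) + 1)⁻¹ := fun k => by positivity
  have hcle : ∀ k : ℕ, ((k : ℝ) + 1)⁻¹ ≤ 1 := fun k =>
    inv_le_one_of_one_le₀ (by linarith [(Nat.cast_nonneg k : (0 : ℝ) ≤ k)])
  have hfd : ∀ (k : ℕ) (x : E), ‖fderiv ℝ (fun x => b (((k : ℝ) + 1)⁻¹ • x)) x‖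
      = ((k : ℝ) + 1)⁻¹ * ‖fderiv ℝ b (((k : ℝ) + 1)⁻¹ • x)‖ := by
    intro k x
    rw [fderiv_comp_smul, norm_smul, Real.norm_of_nonneg (hcpos k).le]
  refine ⟨fun k x => b (((k : ℝ) + 1)⁻¹ • x), C₁ + C₂, fun k => hb.comp (contDiff_const_smul _),
    fun k => hbs.comp_smul (hcpos k).ne', fun k x => b.nonneg, fun k x => b.le_one, fun x => ?_,
    fun k x => ?_, fun x => ?_⟩
  · have h1 : Tendsto (fun k : ℕ => ((k : ℝ) + 1)⁻¹ • x) atTop (𝓝 0) := by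
      simpa using hc0.smul_const x
    have h2 := (b.continuous.tendsto 0).comp h1
    rwa [b.one_of_mem_closedBall (Metric.mem_closedBall_self b.rIn_pos.le)] at h2
  · rw [hfd, add_mul, one_mul]
    refine add_le_add ?_ ?_
    · calc _ ≤ 1 * C₁ := mul_le_mul (hcle k) (hC₁ _) (norm_nonneg _) zero_le_one
        _ = C₁ := one_mul _
    · have h1 := (le_abs_self _).trans (hC₂ (((k : ℝ) + 1)⁻¹ • x))
      rw [Pi.mul_apply, norm_smul, Real.norm_of_nonneg (hcpos k).le] at h1
      linarith
  · have h1 : Tendsto (fun k : ℕ => ((k : ℝ) + 1)⁻¹ * C₁) atTop (𝓝 0) := by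
      simpa using hc0.mul_const C₁
    refine squeeze_zero (fun k => norm_nonneg _) (fun k => ?_) h1
    rw [hfd]
    exact mul_le_mul_of_nonneg_left (hC₁ _) (hcpos k).le

theorem integrable_of_tendsto_of_integral_le {α : Type*} [MeasurableSpace α] {μ : Measure α}
    {f : ℕ → α → ℝ} {g : α → ℝ} {C : ℝ} (hf : ∀ k, Integrable (f k) μ) (h0 : ∀ k x, 0 ≤ f k x)
    (hC : ∀ᶠ k in atTop, ∫ x, f k x ∂μ ≤ C)
    (hlim : ∀ x, Tendsto (fun k => f k x) atTop (𝓝 (g x))) : Integrable g μ := by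
  refine ⟨aestronglyMeasurable_of_tendsto_ae atTop (fun k => (hf k).aestronglyMeasurable)
    (ae_of_all _ hlim), ?_⟩
  have h1 : ∫⁻ x, ‖g x‖ₑ ∂μ ≤ liminf (fun k => ∫⁻ x, ‖f k x‖ₑ ∂μ) atTop := by
    rw [lintegral_congr fun x => (hlim x).enorm.liminf_eq.symm]
    exact lintegral_liminf_le' fun k => (hf k).aestronglyMeasurable.enorm
  refine (h1.trans (liminf_le_of_frequently_le' (x := ENNReal.ofReal C) ?_)).trans_lt
    ENNReal.ofReal_lt_top
  refine (hC.mono fun k hk => ?_).frequently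
  rw [← ofReal_integral_norm_eq_lintegral_enorm (hf k)]
  refine ENNReal.ofReal_le_ofReal ?_
  simpa only [Real.norm_of_nonneg (h0 k _)] using hk

/-! ### Legendre transform and energy density -/

section Legendre

variable {n : ℕ} {φ : Euc n → ℝ}

theorem ContDiff.continuous_gradient {g : Euc n → ℝ} (hg : ContDiff ℝ 1 g) :
    Continuous (gradient g) :=
  (LinearIsometryEquiv.continuous _).comp (hg.continuous_fderiv one_ne_zero)

theorem ConvexOn.add_inner_gradient_le (hc : ConvexOn ℝ univ φ) (hd : Differentiable ℝ φ)
    (x z : Euc n) : φ x + inner ℝ (gradient φ x) (z - x) ≤ φ z := by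
  have h1 : ConvexOn ℝ univ (φ ∘ AffineMap.lineMap (k := ℝ) x z) := by
    simpa using hc.comp_affineMap (AffineMap.lineMap (k := ℝ) x z)
  have h2 : HasDerivAt (φ ∘ AffineMap.lineMap (k := ℝ) x z)
      (inner ℝ (gradient φ x) (z - x)) 0 := by
    rw [inner_gradient_left]
    have h3 : HasFDerivAt φ (fderiv ℝ φ x) (AffineMap.lineMap (k := ℝ) x z 0) := by
      simpa using (hd x).hasFDerivAt
    exact h3.comp_hasDerivAt 0 AffineMap.hasDerivAt_lineMap
  have h4 := h1.le_slope_of_hasDerivAt (mem_univ 0) (mem_univ 1) one_pos h2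
  simp only [slope_def_field, Function.comp_apply, AffineMap.lineMap_apply_zero,
    AffineMap.lineMap_apply_one, sub_zero, div_one] at h4
  linarith

theorem inner_sub_le_legendre (hc : Continuous φ) (hs : SuperLinear φ) (p z : Euc n) :
    inner ℝ p z - φ z ≤ legendre φ p :=
  le_ciSup (bddAbove_range_legendre φ hc hs p) z

/-- Equality in Fenchel–Young: by convexity the graph lies above its tangent plane at `x`, so the
supremum is attained there. -/
theorem legendre_gradient (hconv : ConvexOn ℝ univ φ) (hd : Differentiable ℝ φ)
    (hs : SuperLinear φ) (x : Euc n) :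
    legendre φ (gradient φ x) = inner ℝ (gradient φ x) x - φ x := by
  refine le_antisymm (ciSup_le fun z => ?_) (inner_sub_le_legendre hd.continuous hs _ _)
  have h1 := hconv.add_inner_gradient_le hd x z
  rw [inner_sub_right] at h1
  linarith

theorem convexOn_legendre (hc : Continuous φ) (hs : SuperLinear φ) :
    ConvexOn ℝ univ (legendre φ) := by
  refine ⟨convex_univ, fun p _ q _ a b ha hb hab => ciSup_le fun z => ?_⟩
  have h1 := mul_le_mul_of_nonneg_left (inner_sub_le_legendre hc hs p z) ha
  have h2 := mul_le_mul_of_nonneg_left (inner_sub_le_legendre hc hs q z) hb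
  rw [inner_add_left, real_inner_smul_left, real_inner_smul_left, smul_eq_mul, smul_eq_mul]
  have h3 : φ z = a * φ z + b * φ z := by rw [← add_mul, hab, one_mul]
  linarith

theorem continuous_legendre (hc : Continuous φ) (hs : SuperLinear φ) : Continuous (legendre φ) :=
  (convexOn_legendre hc hs).locallyLipschitz.continuous

variable {g : Euc n → ℝ}

/-- Displays the energy density as the Fenchel–Young defect of the pair `x`, `∇φ(x) - ∇g(x)`, whence
its sign. -/
theorem energyDensity_eq (hconv : ConvexOn ℝ univ φ) (hd : Differentiable ℝ φ)
    (hs : SuperLinear φ) (x : Euc n) :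
    energyDensity φ g x = φ x - inner ℝ (gradient φ x - gradient g x) x
      + legendre φ (gradient φ x - gradient g x) := by
  rw [energyDensity, legendre_gradient hconv hd hs, inner_sub_left, real_inner_comm x (gradient g x)]
  ring

theorem energyDensity_nonneg (hconv : ConvexOn ℝ univ φ) (hd : Differentiable ℝ φ)
    (hs : SuperLinear φ) (x : Euc n) : 0 ≤ energyDensity φ g x := by
  rw [energyDensity_eq hconv hd hs]
  linarith [inner_sub_le_legendre hd.continuous hs (gradient φ x - gradient g x) x]

theorem continuous_energyDensity (hφ : ContDiff ℝ 1 φ) (hs : SuperLinear φ)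
    (hg : ContDiff ℝ 1 g) : Continuous (energyDensity φ g) := by
  have h1 := continuous_legendre hφ.continuous hs
  have h2 := hφ.continuous_gradient
  have h3 := hg.continuous_gradient
  unfold energyDensity
  fun_prop

theorem hasCompactSupport_energyDensity (hgs : HasCompactSupport g) :
    HasCompactSupport (energyDensity φ g) := by
  refine HasCompactSupport.intro (hgs.fderiv ℝ).isCompact fun x hx => ?_
  have h1 : gradient g x = 0 := by
    rw [gradient, image_eq_zero_of_notMem_tsupport hx, map_zero]
  simp [energyDensity, h1]

end Legendre

/-! ### Passing between `μ_φ` and Lebesgue measure -/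

section PotentialMeasure

variable {n : ℕ} {φ : Euc n → ℝ}

theorem integrable_potentialMeasure_iff (hφ : Continuous φ) {f : Euc n → ℝ} :
    Integrable f (potentialMeasure φ) ↔ Integrable fun x => Real.exp (-φ x) * f x := by
  rw [potentialMeasure, integrable_withDensity_iff_integrable_smul₀' (by fun_prop)
    (ae_of_all _ fun _ => ENNReal.ofReal_lt_top)]
  simp only [ENNReal.toReal_ofReal (Real.exp_pos _).le, smul_eq_mul]

theorem integral_potentialMeasure (hφ : Continuous φ) (f : Euc n → ℝ) :
    ∫ x, f x ∂(potentialMeasure φ) = ∫ x, Real.exp (-φ x) * f x := by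
  rw [potentialMeasure, integral_withDensity_eq_integral_toReal_smul (by fun_prop)
    (ae_of_all _ fun _ => ENNReal.ofReal_lt_top)]
  simp only [ENNReal.toReal_ofReal (Real.exp_pos _).le, smul_eq_mul]

end PotentialMeasure

/-! ### Exhaustion by cubes -/

section EucCube

theorem norm_le_of_mem_eucCube {n : ℕ} {r : ℝ} (hr : 0 ≤ r) {x : Euc n}
    (hx : x ∈ eucCube n (-r) r) : ‖x‖ ≤ √n * r := by
  rw [EuclideanSpace.norm_eq]
  calc √(∑ i, ‖x i‖ ^ 2) ≤ √(∑ _i : Fin n, r ^ 2) := by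
        refine Real.sqrt_le_sqrt (Finset.sum_le_sum fun i _ => ?_)
        exact pow_le_pow_left₀ (norm_nonneg _) (abs_le.2 (hx i)) 2
    _ = √n * r := by simp [Real.sqrt_sq hr]

theorem measurableSet_eucCube (n : ℕ) (a b : ℝ) : MeasurableSet (eucCube n a b) := by
  have : eucCube n a b = ⋂ i, (fun x : Euc n => x i) ⁻¹' Icc a b := by
    ext x; simp [eucCube]
  rw [this]
  exact MeasurableSet.iInter fun i =>
    ((EuclideanSpace.proj (𝕜 := ℝ) i).continuous.measurable) measurableSet_Icc

theorem tendsto_setIntegral_eucCube {n : ℕ} {f : Euc n → ℝ} (hf : Integrable f) :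
    Tendsto (fun m : ℕ => ∫ x in eucCube n (-((m : ℝ) + 1)) (m + 1), f x) atTop
      (𝓝 (∫ x, f x)) := by
  have hU : ⋃ m : ℕ, eucCube n (-((m : ℝ) + 1)) (m + 1) = univ := by
    refine eq_univ_of_forall fun x => ?_
    obtain ⟨m, hm⟩ := exists_nat_ge ‖x‖
    refine mem_iUnion.2 ⟨m, fun i => abs_le.1 ?_⟩
    exact (PiLp.norm_apply_le x i).trans (by linarith)
  have h := tendsto_setIntegral_of_monotone (μ := volume) (f := f)
    (fun m : ℕ => measurableSet_eucCube n (-((m : ℝ) + 1)) (m + 1)) ?_ hf.integrableOn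
  · rwa [hU, setIntegral_univ] at h
  · intro m k hmk x hx i
    have : (m : ℝ) ≤ k := Nat.cast_le.2 hmk
    exact ⟨by linarith [(hx i).1], by linarith [(hx i).2]⟩

end EucCube

/-! ### The entropy bound -/

section EntropyBound

variable {n : ℕ} {φ g : Euc n → ℝ}

/-- The transport inequality for `u = χ e^(g-φ)` and `v = e^(-φ)`. The cutoff costs two errors: one
from `∇χ`, where `‖x - y‖ ≤ ‖x‖ + R`, and one from `χ log χ`. -/
theorem integral_cutoff_mul_le {K : Set (Euc n)} {R : ℝ} (hK : EntropyTransportIneq volume K)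
    (hR : ∀ y ∈ K, ‖y‖ ≤ R) (hφ : ContDiff ℝ 1 φ) (hconv : ConvexOn ℝ univ φ)
    (hs : SuperLinear φ) (hg : ContDiff ℝ 1 g) {χ : Euc n → ℝ} (hχ : ContDiff ℝ 1 χ)
    (hχs : HasCompactSupport χ) (hχ0 : ∀ x, 0 ≤ χ x) :
    ∫ x, χ x * (Real.exp (g x - φ x) * g x) ≤
      (∫ x, χ x * (Real.exp (g x - φ x) * energyDensity φ g x))
      + (∫ x, Real.exp (g x - φ x) * ((‖x‖ + R) * ‖fderiv ℝ χ x‖))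
      - (∫ x, Real.exp (g x - φ x) * (χ x * Real.log (χ x)))
      + (∫ x, χ x * Real.exp (g x - φ x)) * Real.log (∫ x, χ x * Real.exp (g x - φ x))
      - (∫ x, χ x * Real.exp (g x - φ x)) * Real.log (∫ y in K, Real.exp (-φ y)) := by
  have hφc := hφ.continuous
  have hgc := hg.continuous
  have hχc := hχ.continuous
  set W : Euc n → ℝ := fun x => Real.exp (g x - φ x) with hW
  have hWc : Continuous W := by fun_prop
  have hW1 : ContDiff ℝ 1 W := (hg.sub hφ).exp
  have hBc := continuous_energyDensity hφ hs hg
  have hdc : Continuous (fderiv ℝ χ) := hχ.continuous_fderiv one_ne_zero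
  have hds : HasCompactSupport (fderiv ℝ χ) := hχs.fderiv ℝ
  have hχl : Continuous fun x => χ x * Real.log (χ x) := Real.continuous_mul_log.comp hχc
  have hχlog := hχs.mul_log
  have hd : Differentiable ℝ φ := hφ.differentiable one_ne_zero
  have hA : Continuous fun x => χ x * (W x * (energyDensity φ g x - φ x)) := by fun_prop
  have hA' : HasCompactSupport fun x => χ x * (W x * (energyDensity φ g x - φ x)) := hχs.mul_right
  have hN : Continuous fun x => W x * ((‖x‖ + R) * ‖fderiv ℝ χ x‖) := by fun_prop
  have hN' : HasCompactSupport fun x => W x * ((‖x‖ + R) * ‖fderiv ℝ χ x‖) :=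
    (hds.norm.mul_left (f := fun x => ‖x‖ + R)).mul_left (f := W)
  have hL : Continuous fun x => W x * (χ x * Real.log (χ x)) := hWc.mul hχl
  have hL' : HasCompactSupport fun x => W x * (χ x * Real.log (χ x)) := hχlog.mul_left (f := W)
  have hG : Continuous fun x => χ x * (W x * (g x - φ x)) := by fun_prop
  have hG' : HasCompactSupport fun x => χ x * (W x * (g x - φ x)) := hχs.mul_right
  have hAi := hA.integrable_of_hasCompactSupport hA' (μ := volume)
  have hNi := hN.integrable_of_hasCompactSupport hN' (μ := volume)
  have hLi := hL.integrable_of_hasCompactSupport hL' (μ := volume)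
  have hGi := hG.integrable_of_hasCompactSupport hG' (μ := volume)
  have hgi : Integrable fun x => χ x * (W x * g x) :=
    Continuous.integrable_of_hasCompactSupport (by fun_prop) hχs.mul_right
  have hφi : Integrable fun x => χ x * (W x * φ x) :=
    Continuous.integrable_of_hasCompactSupport (by fun_prop) hχs.mul_right
  have hBi : Integrable fun x => χ x * (W x * energyDensity φ g x) :=
    Continuous.integrable_of_hasCompactSupport (by fun_prop) hχs.mul_right
  have key := hK (fun x => χ x * W x) (fun y => Real.exp (-φ y))
    (fun x => χ x * (W x * (energyDensity φ g x - φ x)) + W x * ((‖x‖ + R) * ‖fderiv ℝ χ x‖))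
    (hχ.mul hW1) hχs.mul_right (fun x => mul_nonneg (hχ0 x) (Real.exp_pos _).le) (by fun_prop)
    (fun _ => Real.exp_pos _) (hA.add hN) (hA'.add hN') ?_
  · have e1 : ∀ x, χ x * W x * Real.log (χ x * W x)
        = χ x * (W x * (g x - φ x)) + W x * (χ x * Real.log (χ x)) := by
      intro x
      rcases (hχ0 x).eq_or_lt with h0 | hpos
      · simp [← h0]
      · rw [Real.log_mul hpos.ne' (Real.exp_pos _).ne']
        simp only [hW, Real.log_exp]
        ring
    have e2 : ∫ x, χ x * (W x * (g x - φ x))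
        = (∫ x, χ x * (W x * g x)) - ∫ x, χ x * (W x * φ x) := by
      rw [← integral_sub hgi hφi]
      simp only [mul_sub]
    have e3 : ∫ x, χ x * (W x * (energyDensity φ g x - φ x))
        = (∫ x, χ x * (W x * energyDensity φ g x)) - ∫ x, χ x * (W x * φ x) := by
      rw [← integral_sub hBi hφi]
      simp only [mul_sub]
    rw [integral_congr_ae (ae_of_all _ e1), integral_add hGi hLi, integral_add hAi hNi, e2, e3]
      at key
    linarith
  · intro x y hy
    have hWd : HasFDerivAt W (W x • (fderiv ℝ g x - fderiv ℝ φ x)) x :=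
      ((hg.differentiable one_ne_zero x).hasFDerivAt.sub (hd x).hasFDerivAt).exp
    have hud := ((hχ.differentiable one_ne_zero x).hasFDerivAt).mul hWd
    have h1 : fderiv ℝ (fun x => χ x * W x) x = _ := hud.fderiv
    have h2 := inner_sub_le_legendre hφc hs (gradient φ x - gradient g x) y
    have h3 := energyDensity_eq (g := g) hconv hd hs x
    have h4 : fderiv ℝ χ x (x - y) ≤ (‖x‖ + R) * ‖fderiv ℝ χ x‖ := by
      calc _ ≤ ‖fderiv ℝ χ x (x - y)‖ := le_abs_self _
        _ ≤ ‖fderiv ℝ χ x‖ * ‖x - y‖ := ContinuousLinearMap.le_opNorm _ _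
        _ ≤ ‖fderiv ℝ χ x‖ * (‖x‖ + R) := by
          gcongr
          exact (norm_sub_le x y).trans (by gcongr; exact hR y hy)
        _ = _ := mul_comm _ _
    have hWx : 0 < W x := Real.exp_pos _
    have h5 := mul_le_mul_of_nonneg_left h4 hWx.le
    -- Fenchel–Young at `y` with slope `∇φ(x) - ∇g(x)`; the dependence on `y` disappears.
    have h6 : fderiv ℝ g x (x - y) - fderiv ℝ φ x (x - y) - φ y ≤ energyDensity φ g x - φ x := by
      rw [h3]
      simp only [inner_sub_left, inner_gradient_left, map_sub] at h2 ⊢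
      linarith
    have h7 := mul_le_mul_of_nonneg_left h6 (mul_nonneg (hχ0 x) hWx.le)
    rw [h1]
    simp only [add_apply, smul_apply, sub_apply, smul_eq_mul, Real.log_exp]
    linarith

theorem integrable_and_integral_exp_mul_le (hφ : ContDiff ℝ 1 φ) (hconv : ConvexOn ℝ univ φ)
    (hs : SuperLinear φ) (hφi : Integrable fun x => Real.exp (-φ x))
    (hφ1 : ∫ x, Real.exp (-φ x) = 1) (hg : ContDiff ℝ 1 g)
    (hWi : Integrable fun x => Real.exp (g x - φ x))
    (hBi : Integrable fun x => Real.exp (g x - φ x) * energyDensity φ g x) :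
    (Integrable fun x => Real.exp (g x - φ x) * g x) ∧
    ∫ x, Real.exp (g x - φ x) * g x ≤ (∫ x, Real.exp (g x - φ x) * energyDensity φ g x)
      + (∫ x, Real.exp (g x - φ x)) * Real.log (∫ x, Real.exp (g x - φ x)) := by
  have hφc := hφ.continuous
  have hgc := hg.continuous
  obtain ⟨χ, C, hχ, hχs, hχ0, hχ1, hχlim, hχd, hχdlim⟩ := exists_cutoff_seq (Euc n)
  set W : Euc n → ℝ := fun x => Real.exp (g x - φ x) with hW
  have hWc : Continuous W := by fun_prop
  have hW0 : ∀ x, 0 < W x := fun x => Real.exp_pos _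
  have hχc : ∀ k, Continuous (χ k) := fun k => (hχ k).continuous
  have cutoff_lim : ∀ f : Euc n → ℝ, Integrable f →
      Tendsto (fun k => ∫ x, χ k x * f x) atTop (𝓝 (∫ x, f x)) := by
    intro f hf
    refine tendsto_integral_of_dominated_convergence (fun x => ‖f x‖)
      (fun k => (hχc k).aestronglyMeasurable.mul hf.aestronglyMeasurable) hf.norm
      (fun k => ae_of_all _ fun x => ?_) (ae_of_all _ fun x => ?_)
    · rw [norm_mul, Real.norm_of_nonneg (hχ0 k x)]
      exact mul_le_of_le_one_left (norm_nonneg _) (hχ1 k x)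
    · simpa using (hχlim x).mul_const (f x)
  -- Since `‖x‖ + R ≤ (1 + R)(1 + ‖x‖)`, the cutoff bound dominates the integrand by a multiple of
  -- `W`, so no moment of `W` is needed.
  have hgrad_lim : ∀ R : ℝ, 0 ≤ R →
      Tendsto (fun k => ∫ x, W x * ((‖x‖ + R) * ‖fderiv ℝ (χ k) x‖)) atTop (𝓝 0) := by
    intro R hR
    have h := tendsto_integral_of_dominated_convergence (μ := volume)
      (F := fun k x => W x * ((‖x‖ + R) * ‖fderiv ℝ (χ k) x‖)) (f := fun _ => 0)
      (fun x => W x * ((1 + R) * C)) (fun k => ?_) (hWi.mul_const _)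
      (fun k => ae_of_all _ fun x => ?_) (ae_of_all _ fun x => ?_)
    · simpa using h
    · have := (hχ k).continuous_fderiv one_ne_zero
      exact Continuous.aestronglyMeasurable (by fun_prop)
    · have h1 := hχd k x
      have h2 : 0 ≤ ‖x‖ * R := by positivity
      rw [Real.norm_of_nonneg (mul_nonneg (hW0 x).le (by positivity))]
      refine mul_le_mul_of_nonneg_left ?_ (hW0 x).le
      calc _ ≤ (1 + R) * ((1 + ‖x‖) * ‖fderiv ℝ (χ k) x‖) := by
            rw [← mul_assoc]
            gcongr
            linarith
        _ ≤ _ := by gcongr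
    · simpa using ((hχdlim x).const_mul (‖x‖ + R)).const_mul (W x)
  have hlog_lim : Tendsto (fun k => ∫ x, W x * (χ k x * Real.log (χ k x))) atTop (𝓝 0) := by
    have h := tendsto_integral_of_dominated_convergence (μ := volume)
      (F := fun k x => W x * (χ k x * Real.log (χ k x))) (f := fun _ => 0)
      W (fun k => ?_) hWi (fun k => ae_of_all _ fun x => ?_) (ae_of_all _ fun x => ?_)
    · simpa using h
    · exact (hWc.mul (Real.continuous_mul_log.comp (hχc k))).aestronglyMeasurable
    · rw [norm_mul, Real.norm_of_nonneg (hW0 x).le]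
      refine mul_le_of_le_one_right (hW0 x).le ?_
      rcases (hχ0 k x).eq_or_lt with h0 | hpos
      · simp [← h0]
      · rw [mul_comm]
        exact (Real.abs_log_mul_self_lt _ hpos (hχ1 k x)).le
    · have h1 := (Real.continuous_mul_log.tendsto 1).comp (hχlim x)
      simpa using h1.const_mul (W x)
  have hbound : ∀ m : ℕ, ∃ u : ℕ → ℝ, (∀ k, ∫ x, χ k x * (W x * g x) ≤ u k) ∧
      Tendsto u atTop (𝓝 ((∫ x, W x * energyDensity φ g x) + (∫ x, W x) * Real.log (∫ x, W x)
        - (∫ x, W x) * Real.log (∫ y in eucCube n (-((m : ℝ) + 1)) (m + 1), Real.exp (-φ y)))) := by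
    intro m
    have hm : (0 : ℝ) < m + 1 := by positivity
    have hK := entropyTransportIneq_eucCube (by linarith : -((m : ℝ) + 1) < m + 1) n
    have hR0 : 0 ≤ √n * ((m : ℝ) + 1) := by positivity
    refine ⟨_, fun k => integral_cutoff_mul_le hK
      (fun y hy => norm_le_of_mem_eucCube hm.le hy) hφ hconv hs hg (hχ k) (hχs k) (hχ0 k), ?_⟩
    have hZ := cutoff_lim W hWi
    have h1 := ((((cutoff_lim _ hBi).add (hgrad_lim _ hR0)).sub hlog_lim).add
      ((Real.continuous_mul_log.tendsto _).comp hZ)).sub (hZ.mul_const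
        (Real.log (∫ y in eucCube n (-((m : ℝ) + 1)) (m + 1), Real.exp (-φ y))))
    rw [add_zero, sub_zero] at h1
    exact h1
  have hgi : Integrable fun x => W x * g x := by
    obtain ⟨u, hu, hul⟩ := hbound 0
    -- From `t e^t ≥ -1`: adding the integrable `e^(-φ)` makes the integrand nonnegative, so Fatou
    -- applies.
    have hlow : ∀ x, 0 ≤ W x * g x + Real.exp (-φ x) := by
      intro x
      have h1 : 0 ≤ Real.exp (g x) * g x + 1 := by
        have h2 := Real.add_one_le_exp (-g x)
        have h3 : Real.exp (g x) * Real.exp (-g x) = 1 := by rw [← Real.exp_add]; simp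
        have h4 := Real.exp_pos (g x)
        nlinarith
      have h5 : W x = Real.exp (-φ x) * Real.exp (g x) := by
        rw [← Real.exp_add, hW]; ring_nf
      rw [h5]
      nlinarith [Real.exp_pos (-φ x)]
    have hs1 : ∀ k, Integrable fun x => χ k x * (W x * g x) := fun k =>
      Continuous.integrable_of_hasCompactSupport (by have := hχc k; fun_prop) (hχs k).mul_right
    have hs2 : ∀ k, Integrable fun x => χ k x * Real.exp (-φ x) := fun k =>
      Continuous.integrable_of_hasCompactSupport (by have := hχc k; fun_prop) (hχs k).mul_right
    have hsum : Integrable fun x => W x * g x + Real.exp (-φ x) := by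
      have hv : Tendsto (fun k => u k + ∫ x, χ k x * Real.exp (-φ x)) atTop _ :=
        hul.add (cutoff_lim _ hφi)
      obtain ⟨c, hc⟩ : ∃ c, ∀ᶠ k in atTop, u k + ∫ x, χ k x * Real.exp (-φ x) ≤ c :=
        ⟨_, hv.eventually_le_const (lt_add_one _)⟩
      refine integrable_of_tendsto_of_integral_le
        (f := fun k x => χ k x * (W x * g x) + χ k x * Real.exp (-φ x))
        (C := c) (fun k => (hs1 k).add (hs2 k)) (fun k x => ?_)
        (hc.mono fun k hk => ?_) (fun x => ?_)
      · rw [← mul_add]; exact mul_nonneg (hχ0 k x) (hlow x)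
      · rw [integral_add (hs1 k) (hs2 k)]
        exact (add_le_add_left (hu k) _).trans hk
      · simpa using ((hχlim x).mul_const (W x * g x)).add ((hχlim x).mul_const (Real.exp (-φ x)))
    exact (hsum.sub hφi).congr (ae_of_all _ fun x => by simp)
  refine ⟨hgi, ?_⟩
  have hVlim := tendsto_setIntegral_eucCube hφi
  rw [hφ1] at hVlim
  have hlogV := ((hVlim.log one_ne_zero).const_mul (∫ x, W x)).const_sub
    ((∫ x, W x * energyDensity φ g x) + (∫ x, W x) * Real.log (∫ x, W x))
  rw [Real.log_one, mul_zero, sub_zero] at hlogV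
  refine ge_of_tendsto' hlogV fun m => ?_
  obtain ⟨u, hu, hul⟩ := hbound m
  exact le_of_tendsto_of_tendsto' (cutoff_lim _ hgi) hul hu

end EntropyBound

/-! ### The main theorem -/

theorem mainTheorem1 (n : ℕ) (φ : Euc n → ℝ)
    (hφ : ContDiff ℝ 2 φ) (hconv : StrictConvexOn ℝ Set.univ φ) (hsuper : SuperLinear φ)
    (hprob : IsProbabilityMeasure (potentialMeasure φ)) (hint : IntegrabilityHyp φ)
    (g : Euc n → ℝ) (hg : ContDiff ℝ 1 g)
    (hexp : Integrable (fun x => Real.exp (g x)) (potentialMeasure φ)) :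
    (∀ x, 0 ≤ energyDensity φ g x) ∧
    (HasCompactSupport g →
      Integrable (fun x => energyDensity φ g x * Real.exp (g x)) (potentialMeasure φ)) ∧
    (Integrable (fun x => energyDensity φ g x * Real.exp (g x)) (potentialMeasure φ) →
      Integrable (entIntegrand (potentialMeasure φ) fun x => Real.exp (g x))
        (potentialMeasure φ) ∧
      ent (potentialMeasure φ) (fun x => Real.exp (g x)) ≤
        ∫ x, energyDensity φ g x * Real.exp (g x) ∂(potentialMeasure φ)) := by
  have hφ1 : ContDiff ℝ 1 φ := hφ.of_le one_le_two
  have hφc := hφ.continuous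
  have hgc := hg.continuous
  have hBc := continuous_energyDensity hφ1 hsuper hg
  refine ⟨energyDensity_nonneg hconv.convexOn (hφ1.differentiable one_ne_zero) hsuper,
    fun hgs => ?_, fun hB => ?_⟩
  · have hcs := (hasCompactSupport_energyDensity (φ := φ) hgs).mul_right
      (f' := fun x => Real.exp (g x))
    exact Continuous.integrable_of_hasCompactSupport (by fun_prop) hcs
  have hexp_eq : ∀ x, Real.exp (g x - φ x) = Real.exp (-φ x) * Real.exp (g x) := fun x => by
    rw [← Real.exp_add]; ring_nf
  have hφi : Integrable fun x => Real.exp (-φ x) := by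
    simpa using (integrable_potentialMeasure_iff hφc).1 (integrable_const (1 : ℝ))
  have hφint : ∫ x, Real.exp (-φ x) = 1 := by
    simpa using (integral_potentialMeasure hφc fun _ => (1 : ℝ)).symm
  have hWi : Integrable fun x => Real.exp (g x - φ x) := by
    simpa only [hexp_eq] using (integrable_potentialMeasure_iff hφc).1 hexp
  have hBeq : ∀ x, Real.exp (-φ x) * (energyDensity φ g x * Real.exp (g x))
      = Real.exp (g x - φ x) * energyDensity φ g x := fun x => by rw [hexp_eq]; ring
  have hBi : Integrable fun x => Real.exp (g x - φ x) * energyDensity φ g x := by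
    simpa only [hBeq] using (integrable_potentialMeasure_iff hφc).1 hB
  obtain ⟨hgi, hle⟩ := integrable_and_integral_exp_mul_le hφ1 hconv.convexOn hsuper hφi hφint hg
    hWi hBi
  have hZ : ∫ x, Real.exp (g x) ∂(potentialMeasure φ) = ∫ x, Real.exp (g x - φ x) := by
    simp only [integral_potentialMeasure hφc, hexp_eq]
  set Z := ∫ x, Real.exp (g x - φ x) with hZdef
  have hZpos : 0 < Z := by
    rw [← hZ]
    exact integral_exp_pos hexp
  -- Splitting the logarithm turns the entropy into `∫ W g - Z log Z`, with `W = e^(g-φ)`.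
  have hent : ∀ x, Real.exp (-φ x) *
      entIntegrand (potentialMeasure φ) (fun x => Real.exp (g x)) x
      = Real.exp (g x - φ x) * g x - Real.exp (g x - φ x) * Real.log Z := by
    intro x
    rw [entIntegrand, hZ, Real.log_div (Real.exp_pos _).ne' hZpos.ne', Real.log_exp, hexp_eq]
    ring
  constructor
  · rw [integrable_potentialMeasure_iff hφc]
    simp only [hent]
    exact hgi.sub (hWi.mul_const _)
  · rw [ent, integral_potentialMeasure hφc, integral_potentialMeasure hφc]
    simp only [hent, hBeq]
    rw [integral_sub hgi (hWi.mul_const _), integral_mul_const]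
    linarith

end
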